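/- Let $G$ be a finite undirected (simple) graph with node set $\mathcal N$, let $\mathcal N\setminus\mathcal I\subset\mathcal N$ be a set of terminal nodes such that every node is joined by a path in $G$ to some terminal node (for instance, $G$ connected and at least one terminal node), let $F:\mathcal N\setminus\mathcal I\to\mathbb R$ be a terminal payoff and let $\epsilon>0$. Consider the following two-player zero-sum game (the discrete Totalitarian Tug-of-War). A token starts at a node $x$. At each turn at which the token is at a running node (an element of $\mathcal I$), Player I decides either to play a classical round, in which a fair coin is tossed (independently of the past) and the winner moves the token to a neighbouring node of their choice, or to make Player II move the token to a neighbouring node of Player II's choice in exchange for a payment $\epsilon$ to Player I. The game ends at the first time $\tau$ at which the token is at a terminal node $x^\tau$, and Player I then receives from Player II the total payoff $F(x^\tau)+k_\tau\epsilon$, where $k_\tau$ is the number of turns in which Player I made Player II move. The players use pure strategies $S_I,S_{II}$: the action that a player takes at a turn, if given the choice, is a function of the history $(x^0,a^0,x^1,\dots,a^{k-1},x^k)$ of positions and actions before that turn. Set $V^x_{S_I,S_{II}}(I)=V^x_{S_I,S_{II}}(II)=\mathbb E^x_{S_I,S_{II}}[F(x^\tau)+k_\tau\epsilon]\in(-\infty,+\infty]$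 if the game ends almost surely, and $V^x_{S_I,S_{II}}(I)=-\infty$, $V^x_{S_I,S_{II}}(II)=+\infty$ otherwise, and define $$u^I(x)=\sup_{S_I}\inf_{S_{II}}V^x_{S_I,S_{II}}(I),\qquad u^{II}(x)=\inf_{S_{II}}\sup_{S_I}V^x_{S_I,S_{II}}(II).$$ Then the game has a value: $u^I(x)=u^{II}(x)$ for every node $x$. This common value is finite, and it is the unique function $u:\mathcal N\to\mathbb R$ that solves the Dirichlet problem $$u(x)=\max\Big\{\min_{y\sim x}u(y)+\epsilon,\ \tfrac12\Big(\max_{y\sim x}u(y)+\min_{y\sim x}u(y)\Big)\Big\}\quad(x\in\mathcal I),\qquad u(x)=F(x)\quad(x\in\mathcal N\setminus\mathcal I),$$ where $y\sim x$ means that $y$ is a neighbour of $x$ in $G$. -/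

import Mathlib

open MeasureTheory

namespace TotalitarianToW

/-- How the move of a completed turn came about: Player I won the coin toss of a classical round
and moved, Player II won the coin toss of a classical round and moved, or Player I made Player II
move in exchange for the fixed payment `ε`. -/
inductive Action
  | tossI
  | tossII
  | forced

/-- The history `(x⁰, a⁰, x¹, a¹, …, aᵏ⁻¹, xᵏ)` of the positions and actions before the `k`-th
turn. -/
inductive History (V : Type*)
  | start (x : V) : History V
  | snoc (h : History V) (a : Action) (y : V) : History V

namespace History

variable {V : Type*}

/-- The current position `xᵏ`. -/
def current : History V → V
  | start x => x
  | snoc _ _ y => y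

/-- The number of turns so far in which Player I made Player II move for a payment `ε`. -/
def forcedCount : History V → ℕ
  | start _ => 0
  | snoc h Action.forced _ => forcedCount h + 1
  | snoc h _ _ => forcedCount h

end History

/-- A pure strategy of Player I in the game on `G` with terminal nodes `Y`, as a function of the
history: `none` makes Player II move in exchange for `ε`; `some y` calls a classical round, in which
Player I moves to the neighbour `y` of the current position if she wins the toss. -/
structure StrategyI {V : Type*} (G : SimpleGraph V) (Y : Set V) where
  act : History V → Option V
  legal : ∀ h : History V, h.current ∉ Y → ∀ y : V, act h = some y → G.Adj h.current y

/-- A pure strategy of Player II: the neighbour of the current position to which he moves at the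
present turn if he is given the choice, as a function of the history. -/
structure StrategyII {V : Type*} (G : SimpleGraph V) (Y : Set V) where
  act : History V → V
  legal : ∀ h : History V, h.current ∉ Y → G.Adj h.current (act h)

/-- The law of a sequence of independent fair coin tosses (`true`: Player I wins the toss). -/
noncomputable def coinMeasure : Measure (ℕ → Bool) :=
  Measure.infinitePi fun _ : ℕ => (PMF.uniformOfFintype Bool).toMeasure

section Game

variable {V : Type*} {G : SimpleGraph V} {Y : Set V}

open Classical in
/-- One turn of the game, with the coin `c` (which is only used in a classical round).
The game stops at terminal nodes. -/
noncomputable def step (S : StrategyI G Y) (T : StrategyII G Y) (h : History V) (c : Bool) :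
    History V :=
  if h.current ∈ Y then h
  else
    match S.act h with
    | none => h.snoc Action.forced (T.act h)
    | some y => if c = true then h.snoc Action.tossI y else h.snoc Action.tossII (T.act h)

/-- The history after `n` turns, started at `x`, along the coin tosses `ω`. -/
noncomputable def play (S : StrategyI G Y) (T : StrategyII G Y) (x : V) (ω : ℕ → Bool) :
    ℕ → History V
  | 0 => History.start x
  | n + 1 => step S T (play S T x ω n) (ω n)

/-- The game ends almost surely. -/
def EndsAlmostSurely (S : StrategyI G Y) (T : StrategyII G Y) (x : V) : Prop :=
  ∀ᵐ ω ∂coinMeasure, ∃ n : ℕ, (play S T x ω n).current ∈ Y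

/-- The first time `τ` at which the token is at a terminal node
(used only when there is such a time). -/
noncomputable def endTime (S : StrategyI G Y) (T : StrategyII G Y) (x : V) (ω : ℕ → Bool) : ℕ :=
  sInf {n : ℕ | (play S T x ω n).current ∈ Y}

/-- The payoff `F_τ + k_τ ε` that Player I receives from Player II. -/
noncomputable def payoff (F : V → ℝ) (ε : ℝ) (S : StrategyI G Y) (T : StrategyII G Y) (x : V)
    (ω : ℕ → Bool) : ℝ :=
  F (play S T x ω (endTime S T x ω)).current +
    ((play S T x ω (endTime S T x ω)).forcedCount : ℝ) * ε

/-- The expectation, in the extended reals, of a random variable whose positive or negative part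
is integrable: `E[X] = E[X⁺] - E[X⁻]`. The payoff of the game is bounded below, but its expectation
may be `+∞`. -/
noncomputable def expectation (X : (ℕ → Bool) → ℝ) : EReal :=
  ((∫⁻ ω, ENNReal.ofReal (X ω) ∂coinMeasure : ENNReal) : EReal) -
    ((∫⁻ ω, ENNReal.ofReal (-X ω) ∂coinMeasure : ENNReal) : EReal)

open Classical in
/-- The expected payoff for Player I; `-∞` if the game does not end almost surely. -/
noncomputable def expectedPayoffI (F : V → ℝ) (ε : ℝ) (S : StrategyI G Y) (T : StrategyII G Y)
    (x : V) : EReal :=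
  if EndsAlmostSurely S T x then expectation (payoff F ε S T x) else ⊥

open Classical in
/-- The expected payment of Player II; `+∞` if the game does not end almost surely. -/
noncomputable def expectedPayoffII (F : V → ℝ) (ε : ℝ) (S : StrategyI G Y) (T : StrategyII G Y)
    (x : V) : EReal :=
  if EndsAlmostSurely S T x then expectation (payoff F ε S T x) else ⊤

end Game

/-- The value `u^I` of the game for Player I. -/
noncomputable def valueI {V : Type*} (G : SimpleGraph V) (Y : Set V) (F : V → ℝ) (ε : ℝ) (x : V) :
    EReal :=
  ⨆ S : StrategyI G Y, ⨅ T : StrategyII G Y, expectedPayoffI F ε S T x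

/-- The value `u^II` of the game for Player II. -/
noncomputable def valueII {V : Type*} (G : SimpleGraph V) (Y : Set V) (F : V → ℝ) (ε : ℝ) (x : V) :
    EReal :=
  ⨅ T : StrategyII G Y, ⨆ S : StrategyI G Y, expectedPayoffII F ε S T x

/-- `u` solves the Dirichlet problem for the dynamic programming principle: at each running node
`x`, `u x` is the larger of `min u + ε` and `(max u + min u) / 2`, the maximum and minimum being over
the (finitely many) neighbours of `x`, and `u = F` at the terminal nodes. -/
def SolvesDirichletProblem {V : Type*} (G : SimpleGraph V) (Y : Set V) (F : V → ℝ) (ε : ℝ)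
    (u : V → ℝ) : Prop :=
  (∀ x, x ∉ Y →
    u x = max ((⨅ y : G.neighborSet x, u y) + ε)
      (1 / 2 * ((⨆ y : G.neighborSet x, u y) + ⨅ y : G.neighborSet x, u y))) ∧
  ∀ x ∈ Y, u x = F x

end TotalitarianToW

namespace TotalitarianToW

open Filter Topology ENNReal

/-! Every solution `w` of the Dirichlet problem equals the value, which gives both the existence of
the value and uniqueness; a solution exists by monotonicity (`exists_solvesDirichletProblem`).
Player II always moves to a minimum of `w`. Then `w + kε` is a supermartingale, and each of his
moves lowers `w` by at least `ε`, so a bounded run of lost tosses ends the game. Hence `valueII ≤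
w`. Player I cannot simply play optimally in the equation: forcing forever keeps `w + kε` from
decreasing, but Player II might never let the game end. She therefore stops after `N` payments and
walks to a terminal node. The damped function `(1 - θ)(w + kε) + θm`, replaced by the constant `m +
Nε` once `k ≥ N`, is a submartingale bounded above; letting `θ → 0` gives `w ≤ valueI`. With `valueI
≤ valueII` all three agree. The probabilistic tools are `endsAlmostSurely_of_bounded` and optional
stopping by Fatou, `lintegral_play_endTime_le`. -/

instance : IsProbabilityMeasure coinMeasure := by
  unfold coinMeasure
  infer_instance

/-! ### Coin tosses and their flip symmetry -/

theorem map_not_uniformOfFintype :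
    (PMF.uniformOfFintype Bool).toMeasure.map not = (PMF.uniformOfFintype Bool).toMeasure := by
  have : (PMF.uniformOfFintype Bool).map not = PMF.uniformOfFintype Bool := by
    ext b
    cases b <;> simp [PMF.map_apply, tsum_fintype]
  rw [PMF.toMeasure_map not _ (measurable_of_countable _), this]

/-- Turning over the `n`-th coin. -/
def flipCoin (n : ℕ) (ω : ℕ → Bool) : ℕ → Bool := fun i => if i = n then !ω i else ω i

theorem measurable_flipCoin (n : ℕ) : Measurable (flipCoin n) := by
  refine measurable_pi_lambda _ fun i => ?_
  unfold flipCoin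
  by_cases h : i = n
  · simp only [h, if_true]
    exact (measurable_of_countable not).comp (measurable_pi_apply n)
  · simpa [h] using measurable_pi_apply i

/-- This symmetry replaces independence and conditional expectations in the one-turn averaging
`lintegral_play_succ`. -/
theorem map_flipCoin (n : ℕ) : coinMeasure.map (flipCoin n) = coinMeasure := by
  have hf : ∀ i, Measurable (fun b : Bool => if i = n then !b else b) :=
    fun i => measurable_of_countable _
  refine (Measure.infinitePi_map_pi _ hf).trans ?_
  unfold coinMeasure
  congr 1
  ext1 i
  by_cases h : i = n
  · simpa [h] using map_not_uniformOfFintype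
  · simp [h]

/-! ### The random history: averaging, termination, optional stopping -/

section Play

variable {V : Type*} {G : SimpleGraph V} {Y : Set V} (S : StrategyI G Y) (T : StrategyII G Y)

-- All functions of the history become measurable; `play` stays measurable because each turn uses
-- one two-valued coin.
instance : MeasurableSpace (History V) := ⊤

theorem measurable_play (x : V) (n : ℕ) : Measurable fun ω => play S T x ω n := by
  induction n with
  | zero => exact measurable_const
  | succ n ih =>
    have h : (fun ω => play S T x ω (n + 1)) = fun ω =>
        if ω n = true then step S T (play S T x ω n) true
        else step S T (play S T x ω n) false := by
      funext ω
      cases hω : ω n <;> simp [play, hω]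
    rw [h]
    have hn : MeasurableSet {ω : ℕ → Bool | ω n = true} :=
      (measurable_pi_apply (X := fun _ : ℕ => Bool) n) (measurableSet_singleton true)
    exact Measurable.ite hn
      ((measurable_from_top (f := fun h => step S T h true)).comp ih)
      ((measurable_from_top (f := fun h => step S T h false)).comp ih)

theorem play_flipCoin (x : V) (ω : ℕ → Bool) {n m : ℕ} (h : m ≤ n) :
    play S T x (flipCoin n ω) m = play S T x ω m := by
  induction m with
  | zero => rfl
  | succ m ih =>
    have hm : m ≠ n := by omega
    simp [play, ih (by omega), flipCoin, hm]

theorem step_of_terminal {h : History V} (hh : h.current ∈ Y) (c : Bool) : step S T h c = h := by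
  simp [step, hh]

theorem play_of_terminal (x : V) (ω : ℕ → Bool) {n m : ℕ} (hnm : n ≤ m)
    (hn : (play S T x ω n).current ∈ Y) : play S T x ω m = play S T x ω n := by
  induction m, hnm using Nat.le_induction with
  | base => rfl
  | succ m _ ih => rw [play, ih, step_of_terminal S T hn]

theorem current_endTime_mem (x : V) (ω : ℕ → Bool) (h : ∃ n, (play S T x ω n).current ∈ Y) :
    (play S T x ω (endTime S T x ω)).current ∈ Y :=
  Nat.sInf_mem h

/-- The expectation after one more turn averages over the two outcomes of the toss. -/
theorem lintegral_play_succ (x : V) (n : ℕ) (f : History V → ℝ≥0∞) :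
    ∫⁻ ω, f (play S T x ω (n + 1)) ∂coinMeasure =
      ∫⁻ ω, (f (step S T (play S T x ω n) true) + f (step S T (play S T x ω n) false)) / 2
        ∂coinMeasure := by
  have hm : Measurable fun ω => f (play S T x ω (n + 1)) :=
    measurable_from_top.comp (measurable_play S T x (n + 1))
  have hflip : ∫⁻ ω, f (play S T x ω (n + 1)) ∂coinMeasure =
      ∫⁻ ω, f (play S T x (flipCoin n ω) (n + 1)) ∂coinMeasure := by
    conv_lhs => rw [← map_flipCoin n]
    exact lintegral_map hm (measurable_flipCoin n)
  -- The first `n` turns ignore coin `n`, so `ω` and its flip realise exactly the two outcomes of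
  -- the next step.
  have hsum : ∫⁻ ω, (f (step S T (play S T x ω n) true) +
      f (step S T (play S T x ω n) false)) ∂coinMeasure =
      2 * ∫⁻ ω, f (play S T x ω (n + 1)) ∂coinMeasure := by
    rw [two_mul]
    nth_rewrite 2 [hflip]
    rw [← lintegral_add_left hm]
    refine lintegral_congr fun ω => ?_
    rw [play, play, play_flipCoin S T x ω le_rfl]
    cases hω : ω n <;> simp [flipCoin, hω, add_comm]
  simp_rw [div_eq_mul_inv]
  rw [lintegral_mul_const' _ _ (by simp), hsum, mul_comm, ← mul_assoc,
    ENNReal.inv_mul_cancel (by simp) (by simp), one_mul]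

theorem measurableSet_not_ends (x : V) :
    MeasurableSet {ω | ¬ ∃ n, (play S T x ω n).current ∈ Y} := by
  have h (n : ℕ) : MeasurableSet {ω | (play S T x ω n).current ∈ Y} :=
    measurable_play S T x n (t := {h | h.current ∈ Y}) trivial
  exact (MeasurableSet.iUnion h).compl.congr (by ext; simp)

/-- Supermartingale inequality for the history, with a drop at each running turn. -/
theorem lintegral_play_add_le (x : V) (f : History V → ℝ≥0∞) (δ : ℝ≥0∞)
    (hf : ∀ h : History V, h.current ∉ Y →
      (f (step S T h true) + f (step S T h false)) / 2 + δ ≤ f h) (n : ℕ) :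
    ∫⁻ ω, f (play S T x ω n) ∂coinMeasure +
      n * (δ * coinMeasure {ω | ¬ ∃ n, (play S T x ω n).current ∈ Y}) ≤ f (History.start x) := by
  induction n with
  | zero => simp [play]
  | succ n ih =>
    refine le_trans ?_ ih
    push_cast
    rw [add_mul, one_mul, add_comm (_ * _) (δ * _), ← add_assoc]
    gcongr
    -- The drop is charged only on the event that the game never ends: it lies in every event "still
    -- running at turn `n`", so the loss per turn does not depend on `n`.
    rw [lintegral_play_succ, ← lintegral_indicator_const (measurableSet_not_ends S T x) δ,
      ← lintegral_add_right _ (measurable_const.indicator (measurableSet_not_ends S T x))]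
    refine lintegral_mono fun ω => ?_
    by_cases hω : (play S T x ω n).current ∈ Y
    · have : ω ∉ {ω | ¬ ∃ n, (play S T x ω n).current ∈ Y} := by
        simpa using ⟨n, hω⟩
      simp only [Set.indicator_of_notMem this, step_of_terminal S T hω, add_zero,
        ENNReal.add_div, ENNReal.add_halves, le_refl]
    · refine le_trans ?_ (hf _ hω)
      gcongr
      exact Set.indicator_le_self' (by simp) ω

/-- The game ends almost surely if some bounded quantity grows by at least one in every turn in
which the coin shows a fixed side. -/
theorem endsAlmostSurely_of_bounded (x : V) (Ψ : History V → ℝ) (B : ℝ) (c : Bool)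
    (h0 : ∀ h, 0 ≤ Ψ h) (hB : ∀ h, Ψ h ≤ B)
    (hc : ∀ h : History V, h.current ∉ Y → Ψ h + 1 ≤ Ψ (step S T h c)) :
    EndsAlmostSurely S T x := by
  -- On the good side `4 ^ Ψ` at least quadruples, on the other it is at least `0`; the mean is at
  -- least `2 * 4 ^ Ψ ≥ 4 ^ Ψ + 1`. So `4 ^ B - 4 ^ Ψ ≥ 0` drops by `1` in mean per running turn.
  have key := lintegral_play_add_le S T x
    (fun h => ENNReal.ofReal ((4 : ℝ) ^ B - (4 : ℝ) ^ Ψ h)) 1 (fun h hh => ?_)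
  · rw [EndsAlmostSurely, ae_iff]
    set p := coinMeasure {ω | ¬ ∃ n, (play S T x ω n).current ∈ Y}
    by_contra hp
    have htop : Tendsto (fun n : ℕ => (n : ℝ≥0∞) * p) atTop (𝓝 (∞ * p)) :=
      ENNReal.Tendsto.mul_const ENNReal.tendsto_nat_nhds_top (Or.inr (measure_ne_top _ _))
    rw [ENNReal.top_mul hp] at htop
    have := le_of_tendsto' htop fun n => (le_trans (by simp [p]) (key n) :
      (n : ℝ≥0∞) * p ≤ ENNReal.ofReal ((4 : ℝ) ^ B - (4 : ℝ) ^ Ψ (History.start x)))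
    exact ENNReal.ofReal_ne_top (top_le_iff.mp this)
  · have hle (h : History V) : (0 : ℝ) ≤ (4 : ℝ) ^ B - (4 : ℝ) ^ Ψ h :=
      sub_nonneg.mpr (Real.rpow_le_rpow_of_exponent_le (by norm_num) (hB h))
    have h1 : (1 : ℝ) ≤ (4 : ℝ) ^ Ψ h := Real.one_le_rpow (by norm_num) (h0 h)
    have h4 : 4 * (4 : ℝ) ^ Ψ h ≤ (4 : ℝ) ^ Ψ (step S T h c) := by
      refine le_trans (le_of_eq ?_) (Real.rpow_le_rpow_of_exponent_le (by norm_num) (hc h hh))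
      rw [Real.rpow_add (by norm_num), Real.rpow_one, mul_comm]
    have h5 : (0 : ℝ) ≤ (4 : ℝ) ^ Ψ (step S T h !c) := by positivity
    rw [← ENNReal.ofReal_add (hle _) (hle _), ← ENNReal.ofReal_ofNat,
      ← ENNReal.ofReal_div_of_pos (by norm_num), ← ENNReal.ofReal_one,
      ← ENNReal.ofReal_add (div_nonneg (add_nonneg (hle _) (hle _)) (by norm_num)) (by norm_num)]
    refine ENNReal.ofReal_le_ofReal ?_
    cases c <;> simp only [Bool.not_false, Bool.not_true] at h5 <;> linarith

/-- The history is frozen after the end time, so `f` at the end time is almost surely the limit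
along turns, and Fatou's lemma applies. -/
theorem lintegral_play_endTime_le (x : V) (hend : EndsAlmostSurely S T x) (f : History V → ℝ≥0∞)
    (hf : ∀ h : History V, h.current ∉ Y →
      (f (step S T h true) + f (step S T h false)) / 2 ≤ f h) :
    ∫⁻ ω, f (play S T x ω (endTime S T x ω)) ∂coinMeasure ≤ f (History.start x) := by
  have key (n : ℕ) : ∫⁻ ω, f (play S T x ω n) ∂coinMeasure ≤ f (History.start x) := by
    simpa using lintegral_play_add_le S T x f 0 (by simpa using hf) n
  calc ∫⁻ ω, f (play S T x ω (endTime S T x ω)) ∂coinMeasure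
      ≤ ∫⁻ ω, liminf (fun n => f (play S T x ω n)) atTop ∂coinMeasure := by
        refine lintegral_mono_ae ?_
        filter_upwards [hend] with ω hω
        refine le_of_eq (Tendsto.liminf_eq ?_).symm
        refine tendsto_const_nhds.congr' ?_
        filter_upwards [eventually_ge_atTop (endTime S T x ω)] with n hn
        rw [play_of_terminal S T x ω hn (current_endTime_mem S T x ω hω)]
    _ ≤ liminf (fun n => ∫⁻ ω, f (play S T x ω n) ∂coinMeasure) atTop :=
        lintegral_liminf_le fun n => measurable_from_top.comp (measurable_play S T x n)
    _ ≤ f (History.start x) :=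
        liminf_le_of_le (by isBoundedDefault) fun b hb => by
          obtain ⟨n, hn⟩ := hb.exists
          exact hn.trans (key n)

theorem measurable_endTime (x : V) : Measurable (endTime S T x) := by
  have hA (n : ℕ) : MeasurableSet {ω | (play S T x ω n).current ∈ Y} :=
    measurable_play S T x n (t := {h | h.current ∈ Y}) trivial
  refine measurable_of_Iic fun n => ?_
  -- Since `sInf ∅ = 0`, the never-ending tosses lie in every sublevel set.
  have h : endTime S T x ⁻¹' Set.Iic n =
      {ω | ¬ ∃ n, (play S T x ω n).current ∈ Y} ∪ {ω | (play S T x ω n).current ∈ Y} := by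
    ext ω
    simp only [Set.mem_preimage, Set.mem_Iic, Set.mem_union, Set.mem_ofPred_eq]
    constructor
    · intro hn
      by_cases hω : ∃ n, (play S T x ω n).current ∈ Y
      · have := current_endTime_mem S T x ω hω
        exact Or.inr (by rwa [play_of_terminal S T x ω hn this])
      · exact Or.inl hω
    · rintro (hω | hω)
      · have : {n | (play S T x ω n).current ∈ Y} = ∅ := by
          simpa [Set.eq_empty_iff_forall_notMem] using hω
        simp [endTime, this]
      · exact Nat.sInf_le hω
  rw [h]
  exact (measurableSet_not_ends S T x).union (hA n)

theorem measurable_play_endTime (x : V) :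
    Measurable fun ω => play S T x ω (endTime S T x ω) := by
  have : Measurable fun p : ℕ × (ℕ → Bool) => play S T x p.2 p.1 :=
    measurable_from_prod_countable_right fun n => measurable_play S T x n
  exact this.comp ((measurable_endTime S T x).prodMk measurable_id)

end Play

/-! ### Extended expectation and martingale bounds on the payoff -/

theorem expectation_mono {X Z : (ℕ → Bool) → ℝ} (h : ∀ᵐ ω ∂coinMeasure, X ω ≤ Z ω) :
    expectation X ≤ expectation Z := by
  refine EReal.sub_le_sub ?_ ?_ <;> rw [EReal.coe_ennreal_le_coe_ennreal_iff] <;>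
    refine lintegral_mono_ae (h.mono fun ω hω => ENNReal.ofReal_le_ofReal ?_)
  · exact hω
  · exact neg_le_neg hω

theorem expectation_eq_integral {X : (ℕ → Bool) → ℝ} (h : Integrable X coinMeasure) :
    expectation X = ((∫ ω, X ω ∂coinMeasure : ℝ) : EReal) := by
  have h1 : ∫⁻ ω, ENNReal.ofReal (X ω) ∂coinMeasure ≠ ∞ := h.lintegral_lt_top.ne
  have h2 : ∫⁻ ω, ENNReal.ofReal (-X ω) ∂coinMeasure ≠ ∞ := h.neg.lintegral_lt_top.ne
  rw [integral_eq_lintegral_pos_part_sub_lintegral_neg_part h, expectation, EReal.coe_sub,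
    EReal.coe_ennreal_toReal h1, EReal.coe_ennreal_toReal h2]

/-- A random variable bounded below whose mean is controlled through a lower integral. -/
theorem integrable_and_integral_le {X : (ℕ → Bool) → ℝ} (hX : Measurable X) {a c : ℝ}
    (hc : ∀ ω, 0 ≤ X ω + c) (ha : 0 ≤ a + c)
    (h : ∫⁻ ω, ENNReal.ofReal (X ω + c) ∂coinMeasure ≤ ENNReal.ofReal (a + c)) :
    Integrable X coinMeasure ∧ ∫ ω, X ω ∂coinMeasure ≤ a := by
  have hint : Integrable (fun ω => X ω + c) coinMeasure := by
    refine ⟨(hX.add_const c).aestronglyMeasurable, ?_⟩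
    rw [hasFiniteIntegral_iff_ofReal (ae_of_all _ hc)]
    exact h.trans_lt ENNReal.ofReal_lt_top
  have hXi : Integrable X coinMeasure := by
    refine (hint.sub (integrable_const c)).congr (ae_of_all _ fun ω => ?_)
    simp
  refine ⟨hXi, ?_⟩
  rw [← ofReal_integral_eq_lintegral_ofReal hint (ae_of_all _ hc),
    ENNReal.ofReal_le_ofReal_iff ha, integral_add hXi (integrable_const c)] at h
  simpa using h

section Bounds

variable {V : Type*} {G : SimpleGraph V} {Y : Set V} (S : StrategyI G Y) (T : StrategyII G Y)

/-- The final value of a bounded below supermartingale in the history is integrable with mean at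
most its initial value. -/
theorem integrable_endTime_and_integral_le (x : V) (hend : EndsAlmostSurely S T x)
    (M : History V → ℝ) (c : ℝ) (hc : ∀ h, 0 ≤ M h + c)
    (hM : ∀ h : History V, h.current ∉ Y → M (step S T h true) + M (step S T h false) ≤ 2 * M h) :
    Integrable (fun ω => M (play S T x ω (endTime S T x ω))) coinMeasure ∧
      ∫ ω, M (play S T x ω (endTime S T x ω)) ∂coinMeasure ≤ M (History.start x) := by
  refine integrable_and_integral_le
    (measurable_from_top.comp (measurable_play_endTime S T x)) (fun ω => hc _) (hc _) ?_
  refine lintegral_play_endTime_le S T x hend (fun h => ENNReal.ofReal (M h + c)) fun h hh => ?_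
  rw [← ENNReal.ofReal_add (hc _) (hc _), ← ENNReal.ofReal_ofNat,
    ← ENNReal.ofReal_div_of_pos (by norm_num)]
  exact ENNReal.ofReal_le_ofReal (by linarith [hM h hh])

theorem expectation_payoff_le (F : V → ℝ) (ε : ℝ) (x : V) (hend : EndsAlmostSurely S T x)
    (M : History V → ℝ) (c : ℝ) (hc : ∀ h, 0 ≤ M h + c)
    (hM : ∀ h : History V, h.current ∉ Y → M (step S T h true) + M (step S T h false) ≤ 2 * M h)
    (hF : ∀ h : History V, h.current ∈ Y → F h.current + h.forcedCount * ε ≤ M h) :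
    expectation (payoff F ε S T x) ≤ (M (History.start x) : ℝ) := by
  obtain ⟨hi, hle⟩ := integrable_endTime_and_integral_le S T x hend M c hc hM
  refine (expectation_mono (Z := fun ω => M (play S T x ω (endTime S T x ω))) ?_).trans ?_
  · filter_upwards [hend] with ω hω using hF _ (current_endTime_mem S T x ω hω)
  · rw [expectation_eq_integral hi]
    exact EReal.coe_le_coe_iff.mpr hle

/-- Only `L` at the end time is shown integrable, through the supermartingale `-L`; the payoff may
have expectation `+∞`. -/
theorem le_expectation_payoff (F : V → ℝ) (ε : ℝ) (x : V) (hend : EndsAlmostSurely S T x)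
    (L : History V → ℝ) (c : ℝ) (hc : ∀ h, L h ≤ c)
    (hL : ∀ h : History V, h.current ∉ Y → 2 * L h ≤ L (step S T h true) + L (step S T h false))
    (hF : ∀ h : History V, h.current ∈ Y → L h ≤ F h.current + h.forcedCount * ε) :
    (L (History.start x) : ℝ) ≤ expectation (payoff F ε S T x) := by
  obtain ⟨hi, hle⟩ := integrable_endTime_and_integral_le S T x hend (fun h => -L h) c
    (fun h => by linarith [hc h]) (fun h hh => by linarith [hL h hh])
  refine le_trans ?_
    (expectation_mono (X := fun ω => L (play S T x ω (endTime S T x ω))) ?_)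
  · rw [expectation_eq_integral (by simpa using hi.neg), EReal.coe_le_coe_iff]
    rw [integral_neg] at hle
    linarith
  · filter_upwards [hend] with ω hω using hF _ (current_endTime_mem S T x ω hω)

end Bounds

/-! ### Existence for the Dirichlet problem -/

section Graph

variable {V : Type*} {G : SimpleGraph V} {Y : Set V}

/-- A function that is `1`-Lipschitz along edges and can be decreased at each running node. -/
theorem exists_distance (hY : ∀ x : V, ∃ y ∈ Y, G.Reachable x y) :
    ∃ d : V → ℕ, (∀ x y, G.Adj x y → d y ≤ d x + 1) ∧
      ∀ x ∉ Y, ∃ y, G.Adj x y ∧ d y + 1 ≤ d x := by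
  let A : V → Set ℕ := fun x => {n | ∃ y ∈ Y, ∃ p : G.Walk x y, p.length = n}
  have hA (x : V) : sInf (A x) ∈ A x := by
    obtain ⟨y, hy, ⟨p⟩⟩ := hY x
    exact Nat.sInf_mem ⟨p.length, y, hy, p, rfl⟩
  refine ⟨fun x => sInf (A x), fun x y hxy => ?_, fun x hx => ?_⟩
  · obtain ⟨z, hz, p, hp⟩ := hA x
    refine Nat.sInf_le ⟨z, hz, .cons hxy.symm p, ?_⟩
    simp [hp]
  · obtain ⟨z, hz, p, hp⟩ := hA x
    cases p with
    | nil => exact absurd hz hx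
    | cons hxy q =>
      refine ⟨_, hxy, ?_⟩
      rw [SimpleGraph.Walk.length_cons] at hp
      have : sInf (A _) ≤ q.length := Nat.sInf_le ⟨z, hz, q, rfl⟩
      show sInf (A _) + 1 ≤ sInf (A x)
      omega

variable [Finite V]

theorem exists_neighbor_iInf (u : V → ℝ) {x : V} (hx : ∃ y, G.Adj x y) :
    ∃ q, G.Adj x q ∧ (⨅ y : G.neighborSet x, u y) = u q := by
  obtain ⟨y, hy⟩ := hx
  have : Nonempty (G.neighborSet x) := ⟨⟨y, hy⟩⟩
  obtain ⟨q, hq⟩ := exists_eq_ciInf_of_finite (f := fun y : G.neighborSet x => u y)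
  exact ⟨q, q.2, hq.symm⟩

theorem exists_neighbor_iSup (u : V → ℝ) {x : V} (hx : ∃ y, G.Adj x y) :
    ∃ p, G.Adj x p ∧ (⨆ y : G.neighborSet x, u y) = u p := by
  obtain ⟨y, hy⟩ := hx
  have : Nonempty (G.neighborSet x) := ⟨⟨y, hy⟩⟩
  obtain ⟨q, hq⟩ := exists_eq_ciSup_of_finite (f := fun y : G.neighborSet x => u y)
  exact ⟨q, q.2, hq.symm⟩

theorem iInf_neighbor_le (u : V → ℝ) {x y : V} (h : G.Adj x y) :
    (⨅ y : G.neighborSet x, u y) ≤ u y :=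
  ciInf_le (f := fun y : G.neighborSet x => u y) (Set.finite_range _).bddBelow ⟨y, h⟩

theorem le_iSup_neighbor (u : V → ℝ) {x y : V} (h : G.Adj x y) :
    u y ≤ ⨆ y : G.neighborSet x, u y :=
  le_ciSup (f := fun y : G.neighborSet x => u y) (Set.finite_range _).bddAbove ⟨y, h⟩

/-- Solvability of the Dirichlet problem, by the Knaster–Tarski theorem between a constant and a
multiple of the distance to the terminal nodes. -/
theorem exists_solvesDirichletProblem (hY : ∀ x : V, ∃ y ∈ Y, G.Reachable x y) (F : V → ℝ)
    {ε : ℝ} (hε : 0 < ε) : ∃ u, SolvesDirichletProblem G Y F ε u := by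
  classical
  obtain ⟨d, hd1, hd2⟩ := exists_distance hY
  obtain ⟨m, hm⟩ := (Set.finite_range F).bddBelow
  obtain ⟨b, hb⟩ := (Set.finite_range F).bddAbove
  simp only [mem_lowerBounds, mem_upperBounds, Set.forall_mem_range] at hm hb
  have hnb (x : V) (hx : x ∉ Y) : ∃ y, G.Adj x y := (hd2 x hx).imp fun _ h => h.1
  let Φ : (V → ℝ) → V → ℝ := fun u x => if x ∈ Y then F x else
    max ((⨅ y : G.neighborSet x, u y) + ε)
      (1 / 2 * ((⨆ y : G.neighborSet x, u y) + ⨅ y : G.neighborSet x, u y))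
  have hΦ : Monotone Φ := by
    intro u v huv x
    by_cases hx : x ∈ Y
    · simp [Φ, hx]
    · obtain ⟨q, hq, hq'⟩ := exists_neighbor_iInf v (hnb x hx)
      obtain ⟨p, hp, hp'⟩ := exists_neighbor_iSup u (hnb x hx)
      have h1 := (iInf_neighbor_le u hq).trans ((huv q).trans hq'.ge)
      have h2 := hp'.le.trans ((huv p).trans (le_iSup_neighbor v hp))
      simp only [Φ, hx, if_false]
      exact max_le_max (by linarith) (by linarith)
  let lo : V → ℝ := fun _ => m
  let hi : V → ℝ := fun x => b + ε * d x
  have hlo : lo ≤ Φ lo := by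
    intro x
    by_cases hx : x ∈ Y
    · simpa [Φ, hx, lo] using hm x
    · obtain ⟨q, hq, hq'⟩ := exists_neighbor_iInf lo (hnb x hx)
      simp only [Φ, hx, if_false, hq']
      exact le_max_of_le_left (by simp only [lo]; linarith)
  -- Some neighbour is closer to `Y`, so the minimum of `hi` is at most `hi x - ε`, while its
  -- maximum is at most `hi x + ε`; both entries of the maximum are at most `hi x`.
  have hhi : Φ hi ≤ hi := by
    intro x
    by_cases hx : x ∈ Y
    · simp only [Φ, hx, if_true, hi]
      have : 0 ≤ ε * d x := by positivity
      linarith [hb x]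
    · obtain ⟨y, hy, hdy⟩ := hd2 x hx
      obtain ⟨p, hp, hp'⟩ := exists_neighbor_iSup hi (hnb x hx)
      have h1 := iInf_neighbor_le hi hy
      have h2 : (d y : ℝ) + 1 ≤ d x := by exact_mod_cast hdy
      have h3 : (d p : ℝ) ≤ d x + 1 := by exact_mod_cast hd1 x p hp
      have h4 := mul_le_mul_of_nonneg_left h2 hε.le
      have h5 := mul_le_mul_of_nonneg_left h3 hε.le
      simp only [Φ, hx, if_false, hp']
      simp only [hi] at h1 ⊢
      exact max_le (by linarith) (by linarith)
  have hlohi : lo ≤ hi := fun x => by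
    have : 0 ≤ ε * d x := by positivity
    simp only [lo, hi]
    linarith [hm x, hb x]
  -- Makes the order interval a complete lattice, as `lfp` requires.
  have : Fact (lo ≤ hi) := ⟨hlohi⟩
  let φ : Set.Icc lo hi →o Set.Icc lo hi :=
    ⟨fun u => ⟨Φ u, hlo.trans (hΦ u.2.1), (hΦ u.2.2).trans hhi⟩, fun u v huv => hΦ huv⟩
  have hfix : Φ φ.lfp = φ.lfp := congrArg Subtype.val φ.map_lfp
  refine ⟨φ.lfp, fun x hx => ?_, fun x hx => ?_⟩ <;> conv_lhs => rw [← hfix]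
  · simp [Φ, hx]
  · simp [Φ, hx]

end Graph

/-! ### Comparison of the two values -/

section Value

variable {V : Type*} {G : SimpleGraph V} {Y : Set V} {F : V → ℝ} {ε : ℝ}

theorem valueI_le_valueII (x : V) : valueI G Y F ε x ≤ valueII G Y F ε x := by
  refine iSup_le fun S => le_iInf fun T => ?_
  refine (iInf_le _ T).trans (le_trans ?_ (le_iSup _ S))
  unfold expectedPayoffI expectedPayoffII
  split_ifs <;> simp

end Value

namespace History

variable {V : Type*}

@[simp] theorem current_start (x : V) : (start x).current = x := rfl

@[simp] theorem current_snoc (h : History V) (a : Action) (y : V) : (h.snoc a y).current = y := rfl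

@[simp] theorem forcedCount_start (x : V) : (start x).forcedCount = 0 := rfl

@[simp] theorem forcedCount_snoc_forced (h : History V) (y : V) :
    (h.snoc Action.forced y).forcedCount = h.forcedCount + 1 := rfl

@[simp] theorem forcedCount_snoc_tossI (h : History V) (y : V) :
    (h.snoc Action.tossI y).forcedCount = h.forcedCount := rfl

@[simp] theorem forcedCount_snoc_tossII (h : History V) (y : V) :
    (h.snoc Action.tossII y).forcedCount = h.forcedCount := rfl

end History

section Step

variable {V : Type*} {G : SimpleGraph V} {Y : Set V} {S : StrategyI G Y} (T : StrategyII G Y)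
  {h : History V}

theorem step_of_act_eq_none (hh : h.current ∉ Y) (hS : S.act h = none) (c : Bool) :
    step S T h c = h.snoc Action.forced (T.act h) := by
  simp [step, hh, hS]

theorem step_true_of_act_eq_some (hh : h.current ∉ Y) {y : V} (hS : S.act h = some y) :
    step S T h true = h.snoc Action.tossI y := by
  simp [step, hh, hS]

theorem step_false_of_act_eq_some (hh : h.current ∉ Y) {y : V} (hS : S.act h = some y) :
    step S T h false = h.snoc Action.tossII (T.act h) := by
  simp [step, hh, hS]

end Step

/-! ### Strategies built from a solution -/

section Strategies

variable {V : Type*} [Finite V] {G : SimpleGraph V} {Y : Set V} {F : V → ℝ} {ε : ℝ}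

theorem SolvesDirichletProblem.exists_extremal_neighbors {w : V → ℝ}
    (hw : SolvesDirichletProblem G Y F ε w) (hY : ∀ x : V, ∃ y ∈ Y, G.Reachable x y) :
    ∃ p q : V → V, ∀ x ∉ Y, G.Adj x (p x) ∧ G.Adj x (q x) ∧
      (∀ y, G.Adj x y → w (q x) ≤ w y ∧ w y ≤ w (p x)) ∧
      w x = max (w (q x) + ε) (1 / 2 * (w (p x) + w (q x))) := by
  obtain ⟨d, -, hd⟩ := exists_distance hY
  have h (x : V) : ∃ p q : V, x ∉ Y → G.Adj x p ∧ G.Adj x q ∧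
      (∀ y, G.Adj x y → w q ≤ w y ∧ w y ≤ w p) ∧
      w x = max (w q + ε) (1 / 2 * (w p + w q)) := by
    by_cases hx : x ∈ Y
    · exact ⟨x, x, fun h => absurd hx h⟩
    have hnb : ∃ y, G.Adj x y := (hd x hx).imp fun _ h => h.1
    obtain ⟨p, hp, hp'⟩ := exists_neighbor_iSup w hnb
    obtain ⟨q, hq, hq'⟩ := exists_neighbor_iInf w hnb
    refine ⟨p, q, fun _ => ⟨hp, hq, fun y hy => ⟨?_, ?_⟩, ?_⟩⟩
    · exact hq'.ge.trans (iInf_neighbor_le w hy)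
    · exact (le_iSup_neighbor w hy).trans hp'.le
    · rw [hw.1 x hx, hp', hq']
  choose p q hpq using h
  exact ⟨p, q, hpq⟩

/-- Player II guarantees any solution of the Dirichlet problem by moving to its minimum. -/
theorem SolvesDirichletProblem.valueII_le {w : V → ℝ} (hw : SolvesDirichletProblem G Y F ε w)
    (hY : ∀ x : V, ∃ y ∈ Y, G.Reachable x y) (hε : 0 < ε) (x : V) :
    valueII G Y F ε x ≤ (w x : EReal) := by
  obtain ⟨p, q, hpq⟩ := hw.exists_extremal_neighbors hY
  obtain ⟨m, hm⟩ := (Set.finite_range w).bddBelow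
  obtain ⟨b, hb⟩ := (Set.finite_range w).bddAbove
  simp only [mem_lowerBounds, mem_upperBounds, Set.forall_mem_range] at hm hb
  let T : StrategyII G Y := ⟨fun h => q h.current, fun h hh => (hpq _ hh).2.1⟩
  refine (iInf_le _ T).trans (iSup_le fun S => ?_)
  -- On `false` Player II moves whatever Player I chose, and `w` falls by at least `ε`.
  have hend : EndsAlmostSurely S T x := by
    refine endsAlmostSurely_of_bounded S T x (fun h => (b - w h.current) / ε) ((b - m) / ε) false
      (fun h => div_nonneg (sub_nonneg.mpr (hb _)) hε.le)
      (fun h => div_le_div_of_nonneg_right (by linarith [hm h.current]) hε.le) fun h hh => ?_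
    have hq : w (q h.current) + ε ≤ w h.current := by
      rw [(hpq _ hh).2.2.2]
      exact le_max_left _ _
    have hcur : (step S T h false).current = q h.current := by
      rcases hS : S.act h with _ | y
      · simp [step_of_act_eq_none T hh hS, T]
      · simp [step_false_of_act_eq_some T hh hS, T]
    rw [hcur, div_add_one hε.ne']
    exact div_le_div_of_nonneg_right (by linarith) hε.le
  rw [expectedPayoffII, if_pos hend]
  -- Each entry of the maximum defining `w` gives the supermartingale inequality for one choice of
  -- Player I.
  refine (expectation_payoff_le S T F ε x hend (fun h => w h.current + h.forcedCount * ε) (-m)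
    (fun h => ?_) (fun h hh => ?_) fun h hh => ?_).trans ?_
  · have : 0 ≤ h.forcedCount * ε := by positivity
    linarith [hm h.current]
  · obtain ⟨-, -, hy, hwx⟩ := hpq _ hh
    have h1 := hwx.ge.trans' (le_max_left _ _)
    have h2 := hwx.ge.trans' (le_max_right _ _)
    rcases hS : S.act h with _ | y
    · simp only [step_of_act_eq_none T hh hS, History.current_snoc,
        History.forcedCount_snoc_forced, T]
      push_cast
      linarith
    · have := (hy y (S.legal h hh y hS)).2
      simp only [step_true_of_act_eq_some T hh (hS),
        step_false_of_act_eq_some T hh (hS), History.current_snoc,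
        History.forcedCount_snoc_tossI, History.forcedCount_snoc_tossII, T]
      linarith
  · rw [hw.2 _ hh]
  · simp

/-- Player I almost guarantees any solution `w` of the Dirichlet problem: she forces Player II
when that is optimal and otherwise moves to the maximum of `w`, until she has collected enough
payments to walk straight to a terminal node. -/
theorem SolvesDirichletProblem.le_valueI_of_mem_Ioc {w : V → ℝ}
    (hw : SolvesDirichletProblem G Y F ε w)
    (hY : ∀ x : V, ∃ y ∈ Y, G.Reachable x y) (hε : 0 < ε) {m : ℝ} (hmF : ∀ x, m ≤ F x)
    (hm : ∀ x, m ≤ w x) {θ : ℝ} (hθ : θ ∈ Set.Ioc 0 1) (x : V) :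
    (((1 - θ) * w x + θ * m : ℝ) : EReal) ≤ valueI G Y F ε x := by
  classical
  obtain ⟨p, q, hpq⟩ := hw.exists_extremal_neighbors hY
  obtain ⟨d, -, hd⟩ := exists_distance hY
  obtain ⟨D, hD⟩ := (Set.finite_range d).bddAbove
  obtain ⟨b, hb⟩ := (Set.finite_range w).bddAbove
  simp only [mem_upperBounds, Set.forall_mem_range] at hb hD
  obtain ⟨hθ0, hθ1⟩ := hθ
  -- `N` is large enough that `m + Nε`, secured at any terminal node, dominates the damped target
  -- (`hmax`).
  obtain ⟨N, hN⟩ := exists_nat_gt ((b - m) / (θ * ε))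
  have hN0 : 0 < N := by
    have : 0 ≤ (b - m) / (θ * ε) :=
      div_nonneg (by linarith [hm x, hb x]) (by positivity)
    exact_mod_cast this.trans_lt hN
  have hNθ : b - m ≤ θ * (N * ε) := by
    rw [div_lt_iff₀ (by positivity)] at hN
    linarith
  have hmax (y : V) : (1 - θ) * (w y + N * ε) + θ * m ≤ m + N * ε := by
    nlinarith [hm y, hb y]
  have hd' (y : V) : ∃ z, y ∉ Y → G.Adj y z ∧ d z + 1 ≤ d y := by
    by_cases hy : y ∈ Y
    · exact ⟨y, fun h => absurd hy h⟩
    · exact (hd y hy).imp fun _ h _ => h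
  choose e he using hd'
  let S : StrategyI G Y :=
    ⟨fun h => if h.forcedCount < N then
        if w h.current ≤ w (q h.current) + ε then none else some (p h.current)
      else some (e h.current), by
      intro h hh y hy
      split_ifs at hy with h1 h2
      · rw [← Option.some.inj hy]
        exact (hpq _ hh).1
      · rw [← Option.some.inj hy]
        exact (he _ hh).1⟩
  refine le_trans ?_ (le_iSup _ S)
  refine le_iInf fun T => ?_
  have hact1 {h : History V} (h1 : h.forcedCount < N)
      (h2 : w h.current ≤ w (q h.current) + ε) : S.act h = none := by
    simp [S, h1, h2]
  have hact2 {h : History V} (h1 : h.forcedCount < N)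
      (h2 : ¬ w h.current ≤ w (q h.current) + ε) : S.act h = some (p h.current) := by
    simp [S, h1, h2]
  have hact3 {h : History V} (h1 : ¬ h.forcedCount < N) : S.act h = some (e h.current) := by
    simp [S, h1]
  have hend : EndsAlmostSurely S T x := by
    -- A forced move costs at most `1` in `w / ε`, which the `2` per payment outweighs; when forcing
    -- is not optimal, a won toss raises `w` by at least `ε`. After `N` payments a won toss lowers
    -- `d`.
    let Ψ : History V → ℝ := fun h =>
      if h.forcedCount < N then (w h.current - m) / ε + 2 * h.forcedCount
      else (b - m) / ε + 2 * N + (D - d h.current)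
    have hDd (y : V) : (d y : ℝ) ≤ D := by exact_mod_cast hD y
    have hw0 (y : V) : 0 ≤ (w y - m) / ε := div_nonneg (sub_nonneg.mpr (hm y)) hε.le
    have hwb (y : V) : (w y - m) / ε ≤ (b - m) / ε :=
      div_le_div_of_nonneg_right (by linarith [hb y]) hε.le
    have hdiv {y z : V} (h : w y + ε ≤ w z) : (w y - m) / ε + 1 ≤ (w z - m) / ε := by
      rw [div_add_one hε.ne']
      exact div_le_div_of_nonneg_right (by linarith) hε.le
    refine endsAlmostSurely_of_bounded S T x Ψ ((b - m) / ε + 2 * N + D) true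
      (fun h => ?_) (fun h => ?_) fun h hh => ?_
    · simp only [Ψ]
      split_ifs
      · have := hw0 h.current
        positivity
      · have := (hw0 h.current).trans (hwb h.current)
        have := hDd h.current
        have : (0 : ℝ) ≤ N := N.cast_nonneg
        linarith
    · simp only [Ψ]
      split_ifs with h1
      · have : (h.forcedCount : ℝ) ≤ N := by exact_mod_cast h1.le
        have : (0 : ℝ) ≤ D := D.cast_nonneg
        linarith [hwb h.current]
      · have : (0 : ℝ) ≤ d h.current := (d h.current).cast_nonneg
        linarith
    · obtain ⟨-, -, hy, hwx⟩ := hpq _ hh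
      by_cases h1 : h.forcedCount < N
      · by_cases h2 : w h.current ≤ w (q h.current) + ε
        · have h3 := (hy _ (T.legal h hh)).1
          have h4 : (w h.current - m) / ε - 1 ≤ (w (T.act h) - m) / ε := by
            rw [div_sub_one hε.ne']
            exact div_le_div_of_nonneg_right (by linarith) hε.le
          by_cases h5 : h.forcedCount + 1 < N
          · simp only [Ψ, step_of_act_eq_none T hh (hact1 h1 h2), History.current_snoc,
              History.forcedCount_snoc_forced, h1, h5, if_true]
            push_cast
            linarith
          · simp only [Ψ, step_of_act_eq_none T hh (hact1 h1 h2), History.current_snoc,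
              History.forcedCount_snoc_forced, h1, h5, if_true, if_false]
            have : (h.forcedCount : ℝ) + 1 ≤ N := by exact_mod_cast h1
            linarith [hwb h.current, hDd (T.act h)]
        -- Here `w` is the average of its extreme neighbours and exceeds the lower one by more than
        -- `ε`, hence lies as far below the upper one.
        · have h3 : w h.current + ε ≤ w (p h.current) := by
            rcases max_choice (w (q h.current) + ε) (1 / 2 * (w (p h.current) + w (q h.current)))
              with h | h <;> rw [h] at hwx <;> linarith
          simp only [Ψ, step_true_of_act_eq_some T hh (hact2 h1 h2), History.current_snoc,
            History.forcedCount_snoc_tossI, h1, if_true]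
          linarith [hdiv h3]
      · have : (d (e h.current) : ℝ) + 1 ≤ d h.current := by exact_mod_cast (he _ hh).2
        simp only [Ψ, step_true_of_act_eq_some T hh (hact3 h1), History.current_snoc,
          History.forcedCount_snoc_tossI, h1, if_false]
        linarith
  rw [expectedPayoffI, if_pos hend]
  let L : History V → ℝ := fun h =>
    if h.forcedCount < N then (1 - θ) * (w h.current + h.forcedCount * ε) + θ * m else m + N * ε
  have hLle {k : ℕ} (hk : k ≤ N) (y : V) : (1 - θ) * (w y + k * ε) + θ * m ≤ m + N * ε := by
    refine le_trans ?_ (hmax y)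
    have : (k : ℝ) ≤ N := by exact_mod_cast hk
    have := mul_le_mul_of_nonneg_right this hε.le
    nlinarith
  refine le_trans (le_of_eq ?_) (le_expectation_payoff S T F ε x hend L (m + N * ε)
    (fun h => ?_) (fun h hh => ?_) fun h hh => ?_)
  · simp [L, hN0]
  · simp only [L]
    split_ifs with h1
    · exact hLle h1.le _
    · exact le_rfl
  · obtain ⟨-, -, hy, hwx⟩ := hpq _ hh
    have h3 := (hy _ (T.legal h hh)).1
    by_cases h1 : h.forcedCount < N
    · by_cases h2 : w h.current ≤ w (q h.current) + ε
      · have h4 : (1 - θ) * w h.current ≤ (1 - θ) * (w (T.act h) + ε) :=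
          mul_le_mul_of_nonneg_left (by linarith) (by linarith)
        by_cases h5 : h.forcedCount + 1 < N
        · simp only [L, step_of_act_eq_none T hh (hact1 h1 h2), History.current_snoc,
            History.forcedCount_snoc_forced, h1, h5, if_true]
          push_cast
          linarith
        · simp only [L, step_of_act_eq_none T hh (hact1 h1 h2), History.current_snoc,
            History.forcedCount_snoc_forced, h1, h5, if_true, if_false]
          linarith [hLle h1.le h.current]
      · have h4 : 2 * w h.current ≤ w (p h.current) + w (T.act h) := by
          rcases max_choice (w (q h.current) + ε) (1 / 2 * (w (p h.current) + w (q h.current)))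
            with h | h <;> rw [h] at hwx <;> linarith
        have h5 := mul_le_mul_of_nonneg_left h4 (sub_nonneg.mpr hθ1)
        simp only [L, step_true_of_act_eq_some T hh (hact2 h1 h2),
          step_false_of_act_eq_some T hh (hact2 h1 h2), History.current_snoc,
          History.forcedCount_snoc_tossI, History.forcedCount_snoc_tossII, h1, if_true]
        linarith
    · simp only [L, step_true_of_act_eq_some T hh (hact3 h1),
        step_false_of_act_eq_some T hh (hact3 h1), History.current_snoc,
        History.forcedCount_snoc_tossI, History.forcedCount_snoc_tossII, h1, if_false]
      linarith
  · simp only [L]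
    split_ifs with h1
    · have hk : 0 ≤ h.forcedCount * ε := by positivity
      have := hm h.current
      rw [← hw.2 _ hh]
      nlinarith
    · have : (N : ℝ) ≤ h.forcedCount := by exact_mod_cast not_lt.mp h1
      have := mul_le_mul_of_nonneg_right this hε.le
      linarith [hmF h.current]

theorem SolvesDirichletProblem.le_valueI {w : V → ℝ} (hw : SolvesDirichletProblem G Y F ε w)
    (hY : ∀ x : V, ∃ y ∈ Y, G.Reachable x y) (hε : 0 < ε) (x : V) :
    (w x : EReal) ≤ valueI G Y F ε x := by
  obtain ⟨m₁, hm₁⟩ := (Set.finite_range w).bddBelow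
  obtain ⟨m₂, hm₂⟩ := (Set.finite_range F).bddBelow
  simp only [mem_lowerBounds, Set.forall_mem_range] at hm₁ hm₂
  refine EReal.ge_of_forall_gt_iff_ge.mp fun z hz => ?_
  rw [EReal.coe_lt_coe_iff] at hz
  have hm : 0 ≤ w x - min m₁ m₂ := sub_nonneg.mpr ((min_le_left _ _).trans (hm₁ x))
  set r := w x - min m₁ m₂ with hr
  set s := w x - z with hs
  have hs0 : 0 < s := sub_pos.mpr hz
  -- The damping loses `θ * r`, and `θ = s / (r + s)` keeps this at most `s`, also when `r = 0`.
  refine le_trans ?_ (hw.le_valueI_of_mem_Ioc hY hε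
    (fun y => (min_le_right m₁ m₂).trans (hm₂ y)) (fun y => (min_le_left m₁ m₂).trans (hm₁ y))
    (θ := s / (r + s)) ⟨by positivity, div_le_one_of_le₀ (by linarith) (by linarith)⟩ x)
  rw [EReal.coe_le_coe_iff]
  have h1 : s / (r + s) * r ≤ s := by
    rw [div_mul_eq_mul_div, div_le_iff₀ (by linarith)]
    nlinarith
  have h2 : (1 - s / (r + s)) * w x + s / (r + s) * min m₁ m₂ = w x - s / (r + s) * r := by
    rw [hr]
    ring
  rw [h2]
  linarith

theorem SolvesDirichletProblem.valueI_eq {w : V → ℝ} (hw : SolvesDirichletProblem G Y F ε w)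
    (hY : ∀ x : V, ∃ y ∈ Y, G.Reachable x y) (hε : 0 < ε) (x : V) :
    valueI G Y F ε x = (w x : EReal) :=
  le_antisymm ((valueI_le_valueII x).trans (hw.valueII_le hY hε x)) (hw.le_valueI hY hε x)

end Strategies

end TotalitarianToW

/-- The game on a finite graph `G` with terminal nodes `Y`, terminal payoff `F` (only its values on
`Y` matter) and payment `ε > 0`, where a terminal node can be reached from every node. -/
theorem theorem1p2 {V : Type*} [Finite V] (G : SimpleGraph V) (Y : Set V)
    (hY : ∀ x : V, ∃ y ∈ Y, G.Reachable x y) (F : V → ℝ) (ε : ℝ) (hε : 0 < ε) :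
    (∀ x : V, TotalitarianToW.valueI G Y F ε x = TotalitarianToW.valueII G Y F ε x) ∧
    ∃ u : V → ℝ,
      (∀ x : V, TotalitarianToW.valueI G Y F ε x = (u x : EReal)) ∧
      TotalitarianToW.SolvesDirichletProblem G Y F ε u ∧
      ∀ w : V → ℝ, TotalitarianToW.SolvesDirichletProblem G Y F ε w → w = u := by
  obtain ⟨u, hu⟩ := TotalitarianToW.exists_solvesDirichletProblem hY F hε
  refine ⟨fun x => ?_, u, hu.valueI_eq hY hε, hu, fun w hw => funext fun x => ?_⟩
  · refine le_antisymm (TotalitarianToW.valueI_le_valueII x) ?_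
    rw [hu.valueI_eq hY hε]
    exact hu.valueII_le hY hε x
  -- Uniqueness: both solutions equal the same game value.
  · exact EReal.coe_injective ((hw.valueI_eq hY hε x).symm.trans (hu.valueI_eq hY hε x))
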